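/- Let $\mathcal{M}(\mathbb{R}^n)$ be the Banach space of finite signed Borel measures on $\mathbb{R}^n$ with the total variation norm. Let $\Phi:\mathcal{M}(\mathbb{R}^n)\to\mathcal{M}(\mathbb{R}^n)$ be a bounded linear map with the Feller property: for every bounded continuous $f:\mathbb{R}^n\to\mathbb{R}$ there is a bounded continuous $g:\mathbb{R}^n\to\mathbb{R}$ with $\int f\,d\Phi(\mu)=\int g\,d\mu$ for all $\mu\in\mathcal{M}(\mathbb{R}^n)$ (that is, the dual $\Phi^*$ leaves the space of bounded continuous functions invariant). Suppose that $\Phi$ maps the set of Gaussian probability measures on $\mathbb{R}^n$ (degenerate ones, such as Dirac measures, included) into itself. Then $\Phi$ is a Markov operator, i.e. $\Phi(\mu)\ge 0$ whenever $\mu\ge 0$, and $\Phi(\mu)(\mathbb{R}^n)=\mu(\mathbb{R}^n)$ for all $\mu$; and there are real $n\times n$ matrices $K$ and $\alpha$, with $\alpha$ symmetric and positive semidefinite, and a vector $\mathbf{y}_0\in\mathbb{R}^n$ such that for every $\mu\in\mathcal{M}(\mathbb{R}^n)$ and every $\mathbf{k}\in\mathbb{R}^n$ $$\chi_{\Phi(\mu)}(\mathbf{k})=\chi_\mu(K^T\mathbf{k})\,\exp\!\left(-\tfrac14\mathbf{k}^T\alpha\,\mathbf{k}+i\,\mathbf{k}^T\mathbf{y}_0\right),\qquad\text{where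 } \chi_\mu(\mathbf{k})=\int e^{i\mathbf{k}^T\mathbf{x}}\,\mu(d\mathbf{x}).$$ -/

import Mathlib

open MeasureTheory ProbabilityTheory Matrix
open scoped BoundedContinuousFunction

noncomputable section

/-- The finite signed Borel measures on `ℝⁿ`. -/
abbrev SignedBorel (n : ℕ) : Type := SignedMeasure (EuclideanSpace ℝ (Fin n))

/-- The integral `∫ f dμ` of a real or complex (more generally, vector-valued) function against a
finite signed measure. -/
def signedIntegral {n : ℕ} {G : Type*} [NormedAddCommGroup G] [NormedSpace ℝ G]
    (μ : SignedBorel n) (f : EuclideanSpace ℝ (Fin n) → G) : G :=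
  ∫ᵛ x, f x ∂<•μ

/-- The total variation norm `‖μ‖ = |μ|(ℝⁿ)`. -/
def tvNorm {n : ℕ} (μ : SignedBorel n) : ℝ := μ.totalVariation.real Set.univ

/-- The linear map `Φ` is bounded for the total variation norm. -/
def IsTVBounded {n : ℕ} (Φ : SignedBorel n →ₗ[ℝ] SignedBorel n) : Prop :=
  ∃ C : ℝ, ∀ μ : SignedBorel n, tvNorm (Φ μ) ≤ C * tvNorm μ

/-- The Feller property: the dual `Φ*` leaves the space of bounded continuous functions invariant.
A bounded continuous `f` is identified with the functional `μ ↦ ∫ f dμ`; the functional `Φ* f` is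
`μ ↦ ∫ f d(Φ μ)`, and it has to be given by a bounded continuous function `g` again. -/
def IsFeller {n : ℕ} (Φ : SignedBorel n →ₗ[ℝ] SignedBorel n) : Prop :=
  ∀ f : EuclideanSpace ℝ (Fin n) →ᵇ ℝ, ∃ g : EuclideanSpace ℝ (Fin n) →ᵇ ℝ,
    ∀ μ : SignedBorel n, signedIntegral (Φ μ) f = signedIntegral μ g

/-- The set of Gaussian probability measures on `ℝⁿ`, degenerate ones (such as Dirac masses)
included, seen as signed measures. -/
def gaussianMeasures (n : ℕ) : Set (SignedBorel n) :=
  {s | ∃ (γ : Measure (EuclideanSpace ℝ (Fin n))) (_ : IsGaussian γ), s = γ.toSignedMeasure}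

/-- A Markov operator on signed measures: positive and preserving the total mass. -/
structure IsMarkovOperator {n : ℕ} (Φ : SignedBorel n →ₗ[ℝ] SignedBorel n) : Prop where
  nonneg : ∀ μ : SignedBorel n, 0 ≤ μ → 0 ≤ Φ μ
  mass : ∀ μ : SignedBorel n, Φ μ Set.univ = μ Set.univ

/-- The characteristic function `χ_μ(k) = ∫ exp(i kᵀx) μ(dx)` of a finite signed measure. -/
def signedCharFun {n : ℕ} (μ : SignedBorel n) (k : Fin n → ℝ) : ℂ :=
  signedIntegral μ (fun x => Complex.exp (Complex.I * ((k ⬝ᵥ x.ofLp : ℝ) : ℂ)))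

end

/-!
Put `κ x = Φ (δ_x)`, a Gaussian measure. The Feller property, tested on Dirac masses, shows that `κ`
is weakly continuous and that `∫ f d(Φ μ) = ∫ (∫ f dκ_x) dμ(x)` for bounded continuous `f`
(`exists_gaussianMixtureFamily`). So `Φ` is averaging over the Markov kernel `κ`
(`isMarkovOperator_of_kernel`), and it remains to see that the covariance of `κ x` does not depend
on `x` and that its mean is affine in `x`.

Fix a direction `k`. Let `G x e` be the image under `Φ` of the law of `x + ξ e`, with `ξ` a standard
Gaussian variable, and let `M (x, e)` and `V (x, e)` be the mean and the variance of `⟪k, ·⟫` under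
the Gaussian measure `G x e`. As `G x e` is a mixture of the measures `κ (x + ξ e) = G (x + ξ e) 0`,
for all real `l`
`exp (l M (x, e) + l² V (x, e) / 2) = E exp (l M (x + ξ e, 0) + l² V (x + ξ e, 0) / 2)`.
Replacing `x` by `x + θ e` amounts to weighting the right-hand side by `exp (θ ξ - θ² / 2)`. Hence
`(l, θ) ↦ l M (x + θ e, e) + l² V (x + θ e, e) / 2 + θ² / 2` is the logarithm of an integral of
exponentials that are log-convex in `(l, θ)`, and it is jointly convex by Hölder's inequality
(`IsGaussianMixtureFamily.convexOn_cumulant`). Letting `l → ±∞` in the convexity inequalities gives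
that `V (x + θ e, e)` is constant in `θ` (`quadraticCoeff_const_of_convex`) and that
`M (x + θ e, e)` is affine in `θ` (`linearCoeff_affine_of_convex`).

Replacing `e` by `ε e` and letting `ε → 0`, the characteristic functions of `G x (ε e)` converge to
those of `κ x`, so that both properties pass to `κ`
(`IsGaussianMixtureFamily.variance_const`, `IsGaussianMixtureFamily.mean_affine`).
-/

open Filter Topology Set

/-! ### Bounded continuous functions and signed measures -/

lemma signedIntegral_eq_sub {n : ℕ} {G : Type*} [NormedAddCommGroup G] [NormedSpace ℝ G]
    (μ : SignedBorel n) {f : EuclideanSpace ℝ (Fin n) → G}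
    (hp : Integrable f μ.toJordanDecomposition.posPart)
    (hn : Integrable f μ.toJordanDecomposition.negPart) :
    signedIntegral μ f = ∫ x, f x ∂μ.toJordanDecomposition.posPart
      - ∫ x, f x ∂μ.toJordanDecomposition.negPart := by
  have h : μ = μ.toJordanDecomposition.posPart.toSignedMeasure
      - μ.toJordanDecomposition.negPart.toSignedMeasure :=
    μ.toSignedMeasure_toJordanDecomposition.symm
  unfold signedIntegral
  conv_lhs => rw [h]
  rw [VectorMeasure.integral_sub_vectorMeasure, VectorMeasure.integral_toSignedMeasure,
    VectorMeasure.integral_toSignedMeasure]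
  · simpa [VectorMeasure.Integrable] using hp
  · simpa [VectorMeasure.Integrable] using hn

lemma signedIntegral_toSignedMeasure {n : ℕ} {G : Type*} [NormedAddCommGroup G] [NormedSpace ℝ G]
    (μ : Measure (EuclideanSpace ℝ (Fin n))) [IsFiniteMeasure μ]
    (f : EuclideanSpace ℝ (Fin n) → G) :
    signedIntegral μ.toSignedMeasure f = ∫ x, f x ∂μ :=
  VectorMeasure.integral_toSignedMeasure

lemma signedIntegral_complex {n : ℕ} (μ : SignedBorel n)
    (f g : EuclideanSpace ℝ (Fin n) →ᵇ ℝ) :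
    signedIntegral μ (fun x => (f x : ℂ) + (g x : ℂ) * Complex.I)
      = ((signedIntegral μ (fun x => f x) : ℝ) : ℂ)
        + ((signedIntegral μ (fun x => g x) : ℝ) : ℂ) * Complex.I := by
  have key : ∀ ν : Measure (EuclideanSpace ℝ (Fin n)), IsFiniteMeasure ν →
      Integrable (fun x => (f x : ℂ) + (g x : ℂ) * Complex.I) ν ∧
      ∫ x, (f x : ℂ) + (g x : ℂ) * Complex.I ∂ν
        = ((∫ x, f x ∂ν : ℝ) : ℂ) + ((∫ x, g x ∂ν : ℝ) : ℂ) * Complex.I := by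
    intro ν hν
    have hf : Integrable (fun x => (f x : ℂ)) ν := (f.integrable ν).ofReal
    have hg : Integrable (fun x => (g x : ℂ) * Complex.I) ν :=
      (g.integrable ν).ofReal.mul_const _
    refine ⟨hf.add hg, ?_⟩
    rw [integral_add hf hg, integral_mul_const, integral_complex_ofReal, integral_complex_ofReal]
  have hp := key μ.toJordanDecomposition.posPart inferInstance
  have hn := key μ.toJordanDecomposition.negPart inferInstance
  rw [signedIntegral_eq_sub μ hp.1 hn.1, hp.2, hn.2,
    signedIntegral_eq_sub μ (f.integrable _) (f.integrable _),
    signedIntegral_eq_sub μ (g.integrable _) (g.integrable _)]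
  push_cast
  ring

/-- The Feller property for complex-valued bounded continuous functions. -/
lemma IsFeller.complex {n : ℕ} {Φ : SignedBorel n →ₗ[ℝ] SignedBorel n} (hΦ : IsFeller Φ)
    (f : EuclideanSpace ℝ (Fin n) →ᵇ ℂ) : ∃ g : EuclideanSpace ℝ (Fin n) →ᵇ ℂ,
      ∀ μ : SignedBorel n, signedIntegral (Φ μ) f = signedIntegral μ g := by
  let fr : EuclideanSpace ℝ (Fin n) →ᵇ ℝ := BoundedContinuousFunction.ofNormedAddCommGroup
    (fun x => (f x).re) (by fun_prop) ‖f‖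
    (fun x => (Complex.abs_re_le_norm _).trans (f.norm_coe_le_norm x))
  let fi : EuclideanSpace ℝ (Fin n) →ᵇ ℝ := BoundedContinuousFunction.ofNormedAddCommGroup
    (fun x => (f x).im) (by fun_prop) ‖f‖
    (fun x => (Complex.abs_im_le_norm _).trans (f.norm_coe_le_norm x))
  obtain ⟨gr, hgr⟩ := hΦ fr
  obtain ⟨gi, hgi⟩ := hΦ fi
  refine ⟨BoundedContinuousFunction.ofNormedAddCommGroup
    (fun x => (gr x : ℂ) + (gi x : ℂ) * Complex.I) (by fun_prop) (‖gr‖ + ‖gi‖) (fun x => ?_),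
    fun μ => ?_⟩
  · refine (norm_add_le _ _).trans (add_le_add ?_ ?_)
    · simpa using gr.norm_coe_le_norm x
    · simpa using gi.norm_coe_le_norm x
  · have h : (f : EuclideanSpace ℝ (Fin n) → ℂ)
        = fun x => (fr x : ℂ) + (fi x : ℂ) * Complex.I := by
      ext x
      exact (Complex.re_add_im (f x)).symm
    rw [h, signedIntegral_complex, hgr, hgi]
    exact (signedIntegral_complex μ gr gi).symm

/-- A signed measure that integrates nonnegative bounded continuous functions to nonnegative
numbers is nonnegative: its negative part is dominated by its positive part on closed sets, by
outer approximation, hence on all Borel sets, by inner regularity. -/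
lemma signedMeasure_nonneg_of_forall_integral_nonneg {n : ℕ} (ν : SignedBorel n)
    (h : ∀ f : EuclideanSpace ℝ (Fin n) →ᵇ ℝ, (∀ x, 0 ≤ f x) → 0 ≤ signedIntegral ν f) :
    0 ≤ ν := by
  set p := ν.toJordanDecomposition.posPart
  set q := ν.toJordanDecomposition.negPart
  have hint : ∀ f : EuclideanSpace ℝ (Fin n) →ᵇ NNReal, ∫⁻ x, f x ∂q ≤ ∫⁻ x, f x ∂p := by
    intro f
    rw [← ENNReal.toReal_le_toReal (BoundedContinuousFunction.lintegral_lt_top_of_nnreal q f).ne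
      (BoundedContinuousFunction.lintegral_lt_top_of_nnreal p f).ne,
      BoundedContinuousFunction.toReal_lintegral_coe_eq_integral,
      BoundedContinuousFunction.toReal_lintegral_coe_eq_integral]
    let F : EuclideanSpace ℝ (Fin n) →ᵇ ℝ :=
      ⟨⟨fun x => (f x).toReal, by fun_prop⟩, f.map_bounded'⟩
    have h1 := h F (fun x => (f x).2)
    rw [signedIntegral_eq_sub ν (F.integrable _) (F.integrable _)] at h1
    exact sub_nonneg.mp h1
  have hclosed : ∀ F : Set (EuclideanSpace ℝ (Fin n)), IsClosed F → q F ≤ p F := fun F hF =>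
    le_of_tendsto_of_tendsto' (HasOuterApproxClosed.tendsto_lintegral_apprSeq hF q)
      (HasOuterApproxClosed.tendsto_lintegral_apprSeq hF p) (fun k => hint _)
  intro s hs
  rw [ν.apply_eq_posPart_real_sub_negPart_real hs]
  refine sub_nonneg.mpr (ENNReal.toReal_mono (measure_ne_top _ _) ?_)
  change q s ≤ p s
  rw [hs.measure_eq_iSup_isClosed_of_ne_top (measure_ne_top q s)]
  exact iSup_le fun K => iSup_le fun hK => iSup_le fun hKc =>
    (hclosed K hKc).trans (measure_mono hK)

lemma exists_measure_of_nonneg {n : ℕ} {μ : SignedBorel n} (hμ : 0 ≤ μ) :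
    ∃ ρ : Measure (EuclideanSpace ℝ (Fin n)), ∃ _ : IsFiniteMeasure ρ, μ = ρ.toSignedMeasure := by
  have h : 0 ≤[Set.univ] μ := (VectorMeasure.le_restrict_univ_iff_le 0 μ).mpr hμ
  exact ⟨_, inferInstance, (SignedMeasure.toMeasureOfZeroLE_toSignedMeasure μ h).symm⟩

/-! ### Convexity of Gaussian cumulant generating functions -/

lemma leadingCoeff_nonpos_of_forall_quadratic_nonpos {a b c : ℝ}
    (h : ∀ l : ℝ, a * l ^ 2 + b * l + c ≤ 0) : a ≤ 0 := by
  by_contra! ha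
  -- The values at `m` and `-m` add up to `2 (a m² + c)`, which is positive for this `m`.
  obtain ⟨m, hm⟩ : ∃ m : ℝ, m = 1 + |c| / a := ⟨_, rfl⟩
  have h5 := h m
  have h6 := h (-m)
  have h7 : a * m ^ 2 + c ≤ 0 := by nlinarith
  have h8 : 0 ≤ |c| / a := by positivity
  have h9 : a * (|c| / a) = |c| := by field_simp
  have h10 : a * m ^ 2 = a + 2 * |c| + |c| * (|c| / a) := by
    rw [hm]; field_simp; ring
  have h11 : 0 ≤ |c| * (|c| / a) := by positivity
  have := neg_abs_le c
  have := abs_nonneg c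
  linarith

lemma slope_eq_zero_of_forall_affine_nonpos {b c : ℝ} (h : ∀ l : ℝ, b * l + c ≤ 0) : b = 0 := by
  by_contra hb
  have h1 := h ((1 - c) / b)
  rw [mul_div_cancel₀ _ hb] at h1
  linarith

/-- If the function `(l, θ) ↦ l P(θ) + l² Q(θ) / 2 + θ² / 2` is jointly convex, then `Q` is
constant. -/
lemma quadraticCoeff_const_of_convex {P Q : ℝ → ℝ}
    (h : ConvexOn ℝ univ fun z : ℝ × ℝ => z.1 * P z.2 + z.1 ^ 2 * Q z.2 / 2 + z.2 ^ 2 / 2)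
    (s t : ℝ) : Q s = Q t := by
  suffices H : ∀ s t, Q s ≤ Q t from le_antisymm (H s t) (H t s)
  intro s t
  have hr : ∀ r ∈ Ioo (0 : ℝ) 1, r * Q s ≤ Q t := by
    rintro r ⟨h0, h1⟩
    have h1' : 0 < 1 - r := by linarith
    -- `(l, s)` is a convex combination of `(l / r, t)` and a point of the axis `l = 0`.
    have key : ∀ l : ℝ, (r ^ 2 * Q s / 2 - r * Q t / 2) * l ^ 2 + (r * P s - r * P t) * l
        + (s ^ 2 / 2 - r * (t ^ 2 / 2) - (1 - r) * (((s - r * t) / (1 - r)) ^ 2 / 2)) ≤ 0 := by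
      intro l
      have hc := h.2 (mem_univ (l, t)) (mem_univ ((0 : ℝ), (s - r * t) / (1 - r)))
        h0.le h1'.le (by ring)
      have e : r * t + (1 - r) * ((s - r * t) / (1 - r)) = s := by field_simp; ring
      simp only [Prod.smul_mk, Prod.mk_add_mk, smul_eq_mul, mul_zero, add_zero, e] at hc
      nlinarith
    have := leadingCoeff_nonpos_of_forall_quadratic_nonpos key
    have h2 : r * (r * Q s - Q t) ≤ 0 := by nlinarith
    have h3 := nonpos_of_mul_nonpos_right h2 h0
    linarith
  have hlim : Tendsto (fun r : ℝ => r * Q s) (𝓝[<] 1) (𝓝 (1 * Q s)) :=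
    ((continuous_id.mul continuous_const).tendsto 1).mono_left nhdsWithin_le_nhds
  rw [one_mul] at hlim
  refine le_of_tendsto hlim ?_
  filter_upwards [Ioo_mem_nhdsLT (show (0 : ℝ) < 1 by norm_num)] with r hr' using hr r hr'

/-- If the function `(l, θ) ↦ l P(θ) + l² Q(θ) / 2 + θ² / 2` is jointly convex, then `P` is
affine: `Q` is constant, so for fixed `θ` the convexity inequalities are affine in `l`, and an
affine function of constant sign is constant. -/
lemma linearCoeff_affine_of_convex {P Q : ℝ → ℝ}
    (h : ConvexOn ℝ univ fun z : ℝ × ℝ => z.1 * P z.2 + z.1 ^ 2 * Q z.2 / 2 + z.2 ^ 2 / 2)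
    (θ : ℝ) : P θ = (1 - θ) * P 0 + θ * P 1 := by
  have key : ∀ s t r : ℝ, 0 ≤ r → r ≤ 1 → P (r * s + (1 - r) * t) = r * P s + (1 - r) * P t := by
    intro s t r h0 h1
    have := slope_eq_zero_of_forall_affine_nonpos
      (b := P (r * s + (1 - r) * t) - (r * P s + (1 - r) * P t))
      (c := (r * s + (1 - r) * t) ^ 2 / 2 - r * (s ^ 2 / 2) - (1 - r) * (t ^ 2 / 2)) (fun l => by
        have hc := h.2 (mem_univ (l, s)) (mem_univ (l, t)) h0 (sub_nonneg.mpr h1) (by ring)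
        simp only [Prod.smul_mk, Prod.mk_add_mk, smul_eq_mul] at hc
        rw [show r * l + (1 - r) * l = l by ring, quadraticCoeff_const_of_convex h _ s,
          quadraticCoeff_const_of_convex h t s] at hc
        linarith)
    linarith
  rcases lt_or_ge θ 0 with h0 | h0
  · have h1 : 0 < 1 - θ := by linarith
    have := key θ 1 (1 / (1 - θ)) (by positivity) (by rw [div_le_one h1]; linarith)
    rw [show 1 / (1 - θ) * θ + (1 - 1 / (1 - θ)) * 1 = 0 by field_simp; ring] at this
    rw [this]; field_simp; ring
  rcases le_or_gt θ 1 with h1 | h1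
  · have := key 1 0 θ h0 h1
    rw [show θ * 1 + (1 - θ) * 0 = θ by ring] at this
    linarith
  · have h2 : 0 < θ := by linarith
    have := key θ 0 (1 / θ) (by positivity) (by rw [div_le_one h2]; linarith)
    rw [show 1 / θ * θ + (1 - 1 / θ) * 0 = 1 by field_simp; ring] at this
    rw [this]; field_simp; ring

/-- Hölder's inequality for a mixture of Gaussian moment generating functions: since `v ≥ 0`, the
integrand is log-convex in `(l, θ)`, hence so is the integral. -/
lemma convexOn_of_lintegral_exp_eq {Ω : Type*} [MeasurableSpace Ω] (μ : Measure Ω)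
    {u v X : Ω → ℝ} (hv : ∀ ω, 0 ≤ v ω)
    (hmeas : ∀ l θ : ℝ, AEMeasurable
      (fun ω => ENNReal.ofReal (Real.exp (l * u ω + l ^ 2 * v ω / 2 + θ * X ω))) μ)
    {ψ : ℝ × ℝ → ℝ}
    (hψ : ∀ l θ : ℝ, ∫⁻ ω, ENNReal.ofReal (Real.exp (l * u ω + l ^ 2 * v ω / 2 + θ * X ω)) ∂μ
      = ENNReal.ofReal (Real.exp (ψ (l, θ)))) :
    ConvexOn ℝ univ ψ := by
  refine ⟨convex_univ, ?_⟩
  rintro ⟨l₀, θ₀⟩ - ⟨l₁, θ₁⟩ - a b ha hb hab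
  simp only [Prod.smul_mk, Prod.mk_add_mk, smul_eq_mul]
  have hle := ENNReal.lintegral_mul_norm_pow_le (hmeas l₀ θ₀) (hmeas l₁ θ₁) ha hb hab
  rw [hψ, hψ] at hle
  have hpow : ∀ x y : ℝ, ENNReal.ofReal (Real.exp x) ^ y = ENNReal.ofReal (Real.exp (y * x)) := by
    intro x y
    rw [ENNReal.ofReal_rpow_of_pos (Real.exp_pos x), ← Real.exp_mul, mul_comm]
  simp only [hpow, ← ENNReal.ofReal_mul (Real.exp_pos _).le, ← Real.exp_add] at hle
  have hlow : ENNReal.ofReal (Real.exp (ψ (a * l₀ + b * l₁, a * θ₀ + b * θ₁)))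
      ≤ ENNReal.ofReal (Real.exp (a * ψ (l₀, θ₀) + b * ψ (l₁, θ₁))) := by
    rw [← hψ]
    refine (lintegral_mono fun ω => ENNReal.ofReal_le_ofReal (Real.exp_le_exp.mpr ?_)).trans hle
    have hsq : (a * l₀ + b * l₁) ^ 2 ≤ a * l₀ ^ 2 + b * l₁ ^ 2 := by
      obtain rfl : b = 1 - a := by linarith
      nlinarith [mul_nonneg (mul_nonneg ha hb) (sq_nonneg (l₀ - l₁))]
    nlinarith [mul_le_mul_of_nonneg_right hsq (hv ω)]
  rwa [ENNReal.ofReal_le_ofReal_iff (Real.exp_pos _).le, Real.exp_le_exp] at hlow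

/-- Translating a standard Gaussian by `θ` multiplies its density by `exp (θ ξ - θ² / 2)`. -/
lemma lintegral_gaussianReal_shift (θ : ℝ) {F : ℝ → ENNReal} (hF : Measurable F) :
    ∫⁻ ξ, F (θ + ξ) ∂gaussianReal 0 1
      = ∫⁻ ξ, F ξ * ENNReal.ofReal (Real.exp (θ * ξ - θ ^ 2 / 2)) ∂gaussianReal 0 1 := by
  rw [← lintegral_map (f := F) hF (measurable_const_add θ), gaussianReal_map_const_add,
    gaussianReal_of_var_ne_zero _ one_ne_zero, gaussianReal_of_var_ne_zero _ one_ne_zero,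
    lintegral_withDensity_eq_lintegral_mul _ (measurable_gaussianPDF _ _) hF,
    lintegral_withDensity_eq_lintegral_mul _ (measurable_gaussianPDF _ _) (by fun_prop)]
  refine lintegral_congr fun ξ => ?_
  have : gaussianPDF (0 + θ) 1 ξ
      = gaussianPDF 0 1 ξ * ENNReal.ofReal (Real.exp (θ * ξ - θ ^ 2 / 2)) := by
    rw [gaussianPDF, gaussianPDF, ← ENNReal.ofReal_mul (gaussianPDFReal_nonneg _ _ _),
      gaussianPDFReal, gaussianPDFReal, mul_assoc (√_)⁻¹, ← Real.exp_add]
    congr 3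
    simp
    ring
  simp only [Pi.mul_apply, this]
  ring

/-! ### Gaussian families that are mixtures of their degenerate members -/

/-- A family of Gaussian measures `G x e`, indexed by the points `x` and the directions `e` of a
Euclidean space, that is Feller and mixes along lines: `x ↦ G x 0` is weakly continuous, and `G x e`
is the average of the measures `G (x + ξ e) 0` over a standard Gaussian variable `ξ`. -/
structure IsGaussianMixtureFamily {E : Type*} [NormedAddCommGroup E] [InnerProductSpace ℝ E]
    [MeasurableSpace E] (G : E → E → Measure E) : Prop where
  isGaussian : ∀ x e, IsGaussian (G x e)
  continuous_integral : ∀ f : E →ᵇ ℂ, Continuous fun x => ∫ y, f y ∂G x 0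
  integral_eq : ∀ (f : E →ᵇ ℂ) (x e : E),
    ∫ y, f y ∂G x e = ∫ ξ : ℝ, ∫ y, f y ∂G (x + ξ • e) 0 ∂gaussianReal 0 1

section Gaussian

variable {E : Type*} [NormedAddCommGroup E] [InnerProductSpace ℝ E] [MeasurableSpace E]
  [BorelSpace E]

/-- The mean of `⟪k, ·⟫` under `μ`. -/
local notation "mean[" k "," μ "]" => ∫ y, inner ℝ k y ∂μ
/-- The variance of `⟪k, ·⟫` under `μ`. -/
local notation "var[" k "," μ "]" => Var[fun y => inner ℝ k y; μ]

omit [BorelSpace E] in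
lemma map_inner_eq_gaussianReal (μ : Measure E) [IsGaussian μ] (k : E) :
    μ.map (fun y => inner ℝ k y) = gaussianReal mean[k, μ] var[k, μ].toNNReal :=
  IsGaussian.map_eq_gaussianReal (μ := μ) (innerSL ℝ k)

lemma lintegral_exp_inner_of_isGaussian (μ : Measure E) [IsGaussian μ] (k : E) (l : ℝ) :
    ∫⁻ y, ENNReal.ofReal (Real.exp (l * inner ℝ k y)) ∂μ
      = ENNReal.ofReal (Real.exp (l * mean[k, μ] + l ^ 2 * var[k, μ] / 2)) := by
  have hmap := map_inner_eq_gaussianReal μ k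
  have hmeas : Measurable fun y : E => inner ℝ k y := by fun_prop
  have hint : Integrable (fun y => Real.exp (l * inner ℝ k y)) μ := by
    have h := integrable_exp_mul_gaussianReal (μ := mean[k, μ]) (v := var[k, μ].toNNReal) l
    rw [← hmap] at h
    exact h.comp_measurable hmeas
  rw [← ofReal_integral_eq_lintegral_ofReal hint (ae_of_all _ fun y => (Real.exp_pos _).le)]
  have h := mgf_gaussianReal hmap l
  rw [mgf] at h
  rw [h, Real.coe_toNNReal _ (variance_nonneg _ _)]
  congr 2
  ring

namespace IsGaussianMixtureFamily

variable {G : E → E → Measure E} (hG : IsGaussianMixtureFamily G)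
include hG

omit [BorelSpace E] in
lemma continuous_integral_real (f : E →ᵇ ℝ) : Continuous fun x => ∫ y, f y ∂G x 0 := by
  have h := Complex.continuous_re.comp (hG.continuous_integral
    (BoundedContinuousFunction.ofNormedAddCommGroup (fun x => (f x : ℂ)) (by fun_prop) ‖f‖
      (fun x => by simpa using f.norm_coe_le_norm x)))
  refine h.congr fun x => ?_
  simp [integral_complex_ofReal]

omit [BorelSpace E] in
lemma integral_eq_real (f : E →ᵇ ℝ) (x e : E) :
    ∫ y, f y ∂G x e = ∫ ξ : ℝ, ∫ y, f y ∂G (x + ξ • e) 0 ∂gaussianReal 0 1 := by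
  have h := hG.integral_eq
    (BoundedContinuousFunction.ofNormedAddCommGroup (fun x => (f x : ℂ)) (by fun_prop) ‖f‖
      (fun x => by simpa using f.norm_coe_le_norm x)) x e
  simpa [integral_complex_ofReal, ← Complex.ofReal_inj] using h

lemma lintegral_eq_of_bounded {F : E → ℝ} (hF : Continuous F) (h0 : ∀ y, 0 ≤ F y) {C : ℝ}
    (hC : ∀ y, F y ≤ C) :
    (Measurable fun x => ∫⁻ y, ENNReal.ofReal (F y) ∂G x 0) ∧
    ∀ x e, ∫⁻ y, ENNReal.ofReal (F y) ∂G x e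
      = ∫⁻ ξ : ℝ, ∫⁻ y, ENNReal.ofReal (F y) ∂G (x + ξ • e) 0 ∂gaussianReal 0 1 := by
  let f : E →ᵇ ℝ := BoundedContinuousFunction.ofNormedAddCommGroup F hF C
    (fun y => by rw [Real.norm_of_nonneg (h0 y)]; exact hC y)
  have hl : ∀ x e, ∫⁻ y, ENNReal.ofReal (F y) ∂G x e = ENNReal.ofReal (∫ y, f y ∂G x e) := by
    intro x e
    have := hG.isGaussian x e
    exact (ofReal_integral_eq_lintegral_ofReal (f.integrable _) (ae_of_all _ h0)).symm
  have hc := hG.continuous_integral_real f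
  refine ⟨?_, fun x e => ?_⟩
  · simp only [hl]
    exact ENNReal.measurable_ofReal.comp hc.measurable
  · simp only [hl, hG.integral_eq_real f x e]
    refine ofReal_integral_eq_lintegral_ofReal ?_ (ae_of_all _ fun ξ => integral_nonneg h0)
    refine Integrable.of_bound (hc.comp
      (by fun_prop : Continuous fun ξ : ℝ => x + ξ • e)).aestronglyMeasurable ‖f‖
      (ae_of_all _ fun ξ => ?_)
    have := hG.isGaussian (x + ξ • e) 0
    simpa using norm_integral_le_of_norm_le_const (μ := G (x + ξ • e) 0)
      (ae_of_all _ f.norm_coe_le_norm)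

/-- The mixture property extends to unbounded nonnegative continuous functions, by truncation. -/
lemma lintegral_eq {F : E → ℝ} (hF : Continuous F) (h0 : ∀ y, 0 ≤ F y) :
    (Measurable fun x => ∫⁻ y, ENNReal.ofReal (F y) ∂G x 0) ∧
    ∀ x e, ∫⁻ y, ENNReal.ofReal (F y) ∂G x e
      = ∫⁻ ξ : ℝ, ∫⁻ y, ENNReal.ofReal (F y) ∂G (x + ξ • e) 0 ∂gaussianReal 0 1 := by
  have hb := fun N : ℕ => hG.lintegral_eq_of_bounded (F := fun y => min (F y) N) (by fun_prop)
    (fun y => le_min (h0 y) N.cast_nonneg) (fun y => min_le_right _ _)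
  have hmono : ∀ y, Monotone fun N : ℕ => ENNReal.ofReal (min (F y) N) := fun y M N hMN =>
    ENNReal.ofReal_le_ofReal (min_le_min_left _ (by exact_mod_cast hMN))
  have hsup : ∀ y, ENNReal.ofReal (F y) = ⨆ N : ℕ, ENNReal.ofReal (min (F y) N) := by
    intro y
    refine le_antisymm ?_ (iSup_le fun N => ENNReal.ofReal_le_ofReal (min_le_left _ _))
    obtain ⟨N, hN⟩ := exists_nat_ge (F y)
    exact le_iSup_of_le N (by rw [min_eq_left hN])
  have hl : ∀ μ : Measure E, ∫⁻ y, ENNReal.ofReal (F y) ∂μ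
      = ⨆ N : ℕ, ∫⁻ y, ENNReal.ofReal (min (F y) N) ∂μ := by
    intro μ
    simp only [hsup]
    exact lintegral_iSup (fun N => by fun_prop) (fun M N hMN y => hmono y hMN)
  simp only [hl]
  refine ⟨Measurable.iSup fun N => (hb N).1, fun x e => ?_⟩
  rw [lintegral_iSup]
  · exact iSup_congr fun N => (hb N).2 x e
  · intro N
    exact (hb N).1.comp (by fun_prop)
  · exact fun M N hMN ξ => lintegral_mono fun y => hmono y hMN

/-- Along a line, the joint cumulant generating function of the mixed variable `⟪k, ·⟫` and of the
mixing variable `ξ` is convex. -/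
lemma convexOn_cumulant (k x e : E) :
    ConvexOn ℝ univ fun z : ℝ × ℝ => z.1 * mean[k, G (x + z.2 • e) e]
      + z.1 ^ 2 * var[k, G (x + z.2 • e) e] / 2 + z.2 ^ 2 / 2 := by
  have hgauss := hG.isGaussian
  have hm := fun l : ℝ => hG.lintegral_eq (F := fun y => Real.exp (l * inner ℝ k y)) (by fun_prop)
    (fun y => (Real.exp_pos _).le)
  simp only [lintegral_exp_inner_of_isGaussian] at hm
  -- The middle factor is the density of the standard Gaussian translated by `θ`.
  have hmul : ∀ (l θ ξ : ℝ), ENNReal.ofReal (Real.exp (l * mean[k, G (x + ξ • e) 0]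
        + l ^ 2 * var[k, G (x + ξ • e) 0] / 2 + θ * ξ))
      = ENNReal.ofReal (Real.exp (l * mean[k, G (x + ξ • e) 0]
        + l ^ 2 * var[k, G (x + ξ • e) 0] / 2))
        * ENNReal.ofReal (Real.exp (θ * ξ - θ ^ 2 / 2))
        * ENNReal.ofReal (Real.exp (θ ^ 2 / 2)) := by
    intro l θ ξ
    rw [← ENNReal.ofReal_mul (Real.exp_pos _).le, ← Real.exp_add,
      ← ENNReal.ofReal_mul (Real.exp_pos _).le, ← Real.exp_add]
    congr 2
    ring
  have hmeas : ∀ l : ℝ, Measurable fun ξ : ℝ => ENNReal.ofReal (Real.exp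
      (l * mean[k, G (x + ξ • e) 0] + l ^ 2 * var[k, G (x + ξ • e) 0] / 2)) := fun l =>
    (hm l).1.comp (by fun_prop : Measurable fun ξ : ℝ => x + ξ • e)
  refine convexOn_of_lintegral_exp_eq (gaussianReal 0 1)
    (u := fun ξ => mean[k, G (x + ξ • e) 0]) (v := fun ξ => var[k, G (x + ξ • e) 0])
    (X := fun ξ => ξ) (fun ξ => variance_nonneg _ _) (fun l θ => ?_) (fun l θ => ?_)
  · simp only [hmul]
    exact (((hmeas l).mul (by fun_prop)).mul_const _).aemeasurable
  · simp only [hmul]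
    rw [lintegral_mul_const' _ _ ENNReal.ofReal_ne_top,
      ← lintegral_gaussianReal_shift θ (hmeas l)]
    simp only [add_smul, ← add_assoc]
    rw [← (hm l).2 (x + θ • e) e, ← ENNReal.ofReal_mul (Real.exp_pos _).le, ← Real.exp_add]

lemma variance_const_along (k x e : E) (θ : ℝ) :
    var[k, G (x + θ • e) e] = var[k, G x e] := by
  simpa using quadraticCoeff_const_of_convex
      (P := fun θ => mean[k, G (x + θ • e) e]) (Q := fun θ => var[k, G (x + θ • e) e])
      (hG.convexOn_cumulant k x e) θ 0

lemma mean_affine_along (k x e : E) (θ : ℝ) :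
    mean[k, G (x + θ • e) e] = (1 - θ) * mean[k, G x e] + θ * mean[k, G (x + e) e] := by
  simpa using linearCoeff_affine_of_convex
      (P := fun θ => mean[k, G (x + θ • e) e]) (Q := fun θ => var[k, G (x + θ • e) e])
      (hG.convexOn_cumulant k x e) θ

omit [BorelSpace E] in
/-- As the mixing variance tends to zero, the characteristic function converges. -/
lemma tendsto_charFun (k x e : E) :
    Tendsto (fun ε : ℝ => charFun (G x (ε • e)) k) (𝓝[≠] 0) (𝓝 (charFun (G x 0) k)) := by
  have hgauss := hG.isGaussian
  simp only [charFun_eq_integral_innerProbChar]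
  set f := BoundedContinuousFunction.innerProbChar k
  have hc := hG.continuous_integral f
  simp only [hG.integral_eq f x]
  have h0 : ∫ y, f y ∂G x 0 = ∫ ξ : ℝ, ∫ y, f y ∂G (x + ξ • (0 : ℝ) • e) 0 ∂gaussianReal 0 1 := by
    simp
  rw [← hG.integral_eq f x 0, h0]
  refine tendsto_integral_filter_of_dominated_convergence (fun _ => ‖f‖)
    (Eventually.of_forall fun ε => ?_) (Eventually.of_forall fun ε => ae_of_all _ fun ξ => ?_)
    (integrable_const _) (ae_of_all _ fun ξ => ?_)
  · exact (hc.comp (by fun_prop : Continuous fun ξ : ℝ => x + ξ • ε • e)).aestronglyMeasurable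
  · simpa using norm_integral_le_of_norm_le_const (μ := G (x + ξ • ε • e) 0)
      (ae_of_all _ f.norm_coe_le_norm)
  · exact ((hc.comp (by fun_prop : Continuous fun ε : ℝ => x + ξ • ε • e)).tendsto 0).mono_left
      nhdsWithin_le_nhds

end IsGaussianMixtureFamily

lemma charFun_of_isGaussian [SecondCountableTopology E] [CompleteSpace E] (μ : Measure E)
    [IsGaussian μ] (k : E) :
    charFun μ k = ((Real.exp (-(var[k, μ] / 2)) : ℝ) : ℂ)
      * Complex.exp (mean[k, μ] * Complex.I) := by
  rw [IsGaussian.charFun_eq, integral_complex_ofReal, Complex.ofReal_exp, ← Complex.exp_add]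
  congr 1
  push_cast
  ring

lemma norm_charFun_of_isGaussian [SecondCountableTopology E] [CompleteSpace E] (μ : Measure E)
    [IsGaussian μ] (k : E) : ‖charFun μ k‖ = Real.exp (-(var[k, μ] / 2)) := by
  rw [charFun_of_isGaussian, norm_mul, Complex.norm_exp_ofReal_mul_I, mul_one,
    Complex.norm_of_nonneg (Real.exp_pos _).le]

lemma variance_eq_log_norm_charFun [SecondCountableTopology E] [CompleteSpace E] (μ : Measure E)
    [IsGaussian μ] (k : E) : var[k, μ] = -2 * Real.log ‖charFun μ k‖ := by
  rw [norm_charFun_of_isGaussian, Real.log_exp]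
  ring

lemma exp_mean_eq_charFun_div [SecondCountableTopology E] [CompleteSpace E] (μ : Measure E)
    [IsGaussian μ] (k : E) (s : ℝ) :
    Complex.exp ((s * mean[k, μ] : ℝ) * Complex.I)
      = charFun μ (s • k) / (‖charFun μ (s • k)‖ : ℝ) := by
  have h : mean[s • k, μ] = s * mean[k, μ] := by
    simp only [real_inner_smul_left, integral_const_mul]
  have hne : ((Real.exp (-(var[s • k, μ] / 2)) : ℝ) : ℂ) ≠ 0 := by
    exact_mod_cast (Real.exp_pos _).ne'
  rw [norm_charFun_of_isGaussian, charFun_of_isGaussian, h, mul_div_cancel_left₀ _ hne]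

lemma eq_zero_of_forall_exp_mul_I_eq_one {d : ℝ}
    (h : ∀ s : ℝ, Complex.exp ((s * d : ℝ) * Complex.I) = 1) : d = 0 := by
  by_contra hd
  have h1 := h (Real.pi / d)
  rw [div_mul_cancel₀ _ hd, Complex.exp_pi_mul_I] at h1
  norm_num at h1

namespace IsGaussianMixtureFamily

variable [SecondCountableTopology E] [CompleteSpace E] {G : E → E → Measure E}
  (hG : IsGaussianMixtureFamily G)
include hG

/-- The variance of `⟪k, ·⟫` under `G x 0` does not depend on `x`: at scale `ε` it is constant along
the line through `x` and `x'`, and this survives the limit `ε → 0`. -/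
lemma variance_const (k x x' : E) : var[k, G x 0] = var[k, G x' 0] := by
  have hgauss := hG.isGaussian
  have hlim : ∀ x e : E, Tendsto (fun ε : ℝ => var[k, G x (ε • e)]) (𝓝[≠] 0)
      (𝓝 var[k, G x 0]) := by
    intro x e
    simp only [variance_eq_log_norm_charFun]
    refine (((hG.tendsto_charFun k x e).norm).log ?_).const_mul _
    rw [norm_charFun_of_isGaussian]
    exact (Real.exp_pos _).ne'
  refine tendsto_nhds_unique (hlim x (x' - x)) ((hlim x' (x' - x)).congr' ?_)
  filter_upwards [self_mem_nhdsWithin] with ε hε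
  have h := hG.variance_const_along k x (ε • (x' - x)) ε⁻¹
  rwa [inv_smul_smul₀ hε, add_sub_cancel] at h

/-- The mean of `⟪k, ·⟫` under `G x 0` is affine in `x`. The means are read off from the phases of
the characteristic functions, at all scales `s`, so that no bound on them is needed to pass to the
limit `ε → 0`. -/
lemma mean_affine (k x e : E) (θ : ℝ) :
    mean[k, G (x + θ • e) 0] = (1 - θ) * mean[k, G x 0] + θ * mean[k, G (x + e) 0] := by
  have hgauss := hG.isGaussian
  have hlim : ∀ (x : E) (s : ℝ), Tendsto
      (fun ε : ℝ => Complex.exp ((s * mean[k, G x (ε • e)] : ℝ) * Complex.I)) (𝓝[≠] 0)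
      (𝓝 (Complex.exp ((s * mean[k, G x 0] : ℝ) * Complex.I))) := by
    intro x s
    simp only [exp_mean_eq_charFun_div]
    have h := hG.tendsto_charFun (s • k) x e
    refine h.div ((Complex.continuous_ofReal.tendsto _).comp h.norm) ?_
    rw [norm_charFun_of_isGaussian]
    exact_mod_cast (Real.exp_pos _).ne'
  rw [← sub_eq_zero]
  refine eq_zero_of_forall_exp_mul_I_eq_one fun s => ?_
  have h := ((hlim (x + θ • e) s).mul (hlim x (-(s * (1 - θ))))).mul (hlim (x + e) (-(s * θ)))
  simp only [← Complex.exp_add, ← add_mul, ← Complex.ofReal_add] at h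
  have h1 := tendsto_nhds_unique_of_eventuallyEq h (tendsto_const_nhds (x := (1 : ℂ))) ?_
  · rw [← h1]
    congr 3
    ring
  · filter_upwards [self_mem_nhdsWithin] with ε hε
    have hθ := hG.mean_affine_along k x (ε • e) (θ * ε⁻¹)
    have h1 := hG.mean_affine_along k x (ε • e) ε⁻¹
    rw [mul_smul, inv_smul_smul₀ hε] at hθ
    rw [inv_smul_smul₀ hε] at h1
    rw [hθ, h1, ← Complex.exp_zero, ← zero_mul Complex.I, ← Complex.ofReal_zero]
    congr 3
    ring

end IsGaussianMixtureFamily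

end Gaussian

/-! ### The kernel of a Gaussian-preserving Feller operator -/

/-- The law of `x + ξ e` for a standard Gaussian variable `ξ`. For `e = 0` it is the Dirac mass at
`x`. -/
noncomputable def gaussianOnLine {n : ℕ} (x e : EuclideanSpace ℝ (Fin n)) :
    Measure (EuclideanSpace ℝ (Fin n)) :=
  (gaussianReal 0 1).map fun ξ => x + ξ • e

instance isGaussian_gaussianOnLine {n : ℕ} (x e : EuclideanSpace ℝ (Fin n)) :
    IsGaussian (gaussianOnLine x e) := by
  have h : gaussianOnLine x e = ((gaussianReal 0 1).map
      (ContinuousLinearMap.toSpanSingleton ℝ e)).map (fun y => x + y) := by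
    rw [Measure.map_map (by fun_prop) (by fun_prop)]
    rfl
  rw [h]
  infer_instance

lemma integral_gaussianOnLine {n : ℕ} {F : Type*} [NormedAddCommGroup F] [NormedSpace ℝ F]
    (g : EuclideanSpace ℝ (Fin n) →ᵇ F) (x e : EuclideanSpace ℝ (Fin n)) :
    ∫ y, g y ∂gaussianOnLine x e = ∫ ξ : ℝ, g (x + ξ • e) ∂gaussianReal 0 1 :=
  integral_map (by fun_prop) g.continuous.aestronglyMeasurable

/-- A Gaussian-preserving Feller operator averages the Gaussian kernel `x ↦ Φ(δ_x) = G x 0`. -/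
lemma exists_gaussianMixtureFamily {n : ℕ} {Φ : SignedBorel n →ₗ[ℝ] SignedBorel n}
    (hfeller : IsFeller Φ) (hgauss : Set.MapsTo Φ (gaussianMeasures n) (gaussianMeasures n)) :
    ∃ G : EuclideanSpace ℝ (Fin n) → EuclideanSpace ℝ (Fin n) →
        Measure (EuclideanSpace ℝ (Fin n)),
      IsGaussianMixtureFamily G ∧
      (∀ (f : EuclideanSpace ℝ (Fin n) →ᵇ ℝ) (μ : SignedBorel n),
        signedIntegral (Φ μ) f = signedIntegral μ fun x => ∫ y, f y ∂G x 0) ∧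
      ∀ (f : EuclideanSpace ℝ (Fin n) →ᵇ ℂ) (μ : SignedBorel n),
        signedIntegral (Φ μ) f = signedIntegral μ fun x => ∫ y, f y ∂G x 0 := by
  have hmaps : ∀ x e : EuclideanSpace ℝ (Fin n), ∃ (γ : Measure (EuclideanSpace ℝ (Fin n)))
      (_ : IsGaussian γ), Φ (gaussianOnLine x e).toSignedMeasure = γ.toSignedMeasure := fun x e =>
    hgauss ⟨gaussianOnLine x e, inferInstance, rfl⟩
  choose G hG hΦ using hmaps
  have hreal : ∀ (f g : EuclideanSpace ℝ (Fin n) →ᵇ ℝ),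
      (∀ μ, signedIntegral (Φ μ) f = signedIntegral μ g) → ∀ x, ∫ y, f y ∂G x 0 = g x := by
    intro f g h x
    have hx := h (gaussianOnLine x 0).toSignedMeasure
    rw [hΦ, signedIntegral_toSignedMeasure, signedIntegral_toSignedMeasure,
      integral_gaussianOnLine] at hx
    simpa using hx
  have hline : ∀ (f g : EuclideanSpace ℝ (Fin n) →ᵇ ℂ),
      (∀ μ, signedIntegral (Φ μ) f = signedIntegral μ g) →
      ∀ x e, ∫ y, f y ∂G x e = ∫ ξ : ℝ, g (x + ξ • e) ∂gaussianReal 0 1 := by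
    intro f g h x e
    have hx := h (gaussianOnLine x e).toSignedMeasure
    rwa [hΦ, signedIntegral_toSignedMeasure, signedIntegral_toSignedMeasure,
      integral_gaussianOnLine] at hx
  have hcomplex : ∀ (f g : EuclideanSpace ℝ (Fin n) →ᵇ ℂ),
      (∀ μ, signedIntegral (Φ μ) f = signedIntegral μ g) → ∀ x, ∫ y, f y ∂G x 0 = g x := by
    intro f g h x
    simpa using hline f g h x 0
  refine ⟨G, ⟨hG, fun f => ?_, fun f x e => ?_⟩, fun f μ => ?_, fun f μ => ?_⟩
  · obtain ⟨g, hg⟩ := hfeller.complex f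
    simpa only [hcomplex f g hg] using g.continuous
  · obtain ⟨g, hg⟩ := hfeller.complex f
    simp only [hcomplex f g hg, hline f g hg]
  · obtain ⟨g, hg⟩ := hfeller f
    simp only [hreal f g hg, hg]
  · obtain ⟨g, hg⟩ := hfeller.complex f
    simp only [hcomplex f g hg, hg]

/-- An operator that averages a kernel of probability measures is a Markov operator. -/
lemma isMarkovOperator_of_kernel {n : ℕ} {Φ : SignedBorel n →ₗ[ℝ] SignedBorel n}
    {κ : EuclideanSpace ℝ (Fin n) → Measure (EuclideanSpace ℝ (Fin n))}
    (hκ : ∀ x, IsProbabilityMeasure (κ x))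
    (h : ∀ (f : EuclideanSpace ℝ (Fin n) →ᵇ ℝ) (μ : SignedBorel n),
      signedIntegral (Φ μ) f = signedIntegral μ fun x => ∫ y, f y ∂κ x) :
    IsMarkovOperator Φ := by
  refine ⟨fun μ hμ => signedMeasure_nonneg_of_forall_integral_nonneg _ fun f hf => ?_, fun μ => ?_⟩
  · obtain ⟨ρ, hρ, rfl⟩ := exists_measure_of_nonneg hμ
    rw [h, signedIntegral_toSignedMeasure]
    exact integral_nonneg fun x => integral_nonneg hf
  · have hone : ∀ ν : SignedBorel n, signedIntegral ν (fun _ => (1 : ℝ)) = ν univ := by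
      intro ν
      rw [signedIntegral_eq_sub ν (integrable_const _) (integrable_const _),
        ν.apply_eq_posPart_real_sub_negPart_real MeasurableSet.univ]
      simp
    rw [← hone, ← hone μ]
    have h1 := h 1 μ
    simp only [BoundedContinuousFunction.coe_one, Pi.one_apply, integral_const, probReal_univ,
      smul_eq_mul, mul_one] at h1
    exact h1

/-! ### Matrix form of the parameters -/

/-- A map that is affine along every line is affine. -/
lemma exists_matrix_of_affine {n : ℕ} {m : EuclideanSpace ℝ (Fin n) → EuclideanSpace ℝ (Fin n)}
    (hm : ∀ (x e : EuclideanSpace ℝ (Fin n)) (θ : ℝ),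
      m (x + θ • e) = (1 - θ) • m x + θ • m (x + e)) :
    ∃ K : Matrix (Fin n) (Fin n) ℝ, ∀ x, (m x).ofLp = K *ᵥ x.ofLp + (m 0).ofLp := by
  have hsmul : ∀ (θ : ℝ) x, m (θ • x) = (1 - θ) • m 0 + θ • m x := by
    intro θ x
    simpa using hm 0 x θ
  let A : EuclideanSpace ℝ (Fin n) →ₗ[ℝ] EuclideanSpace ℝ (Fin n) :=
    { toFun := fun x => m x - m 0
      map_add' := fun x y => by
        -- The midpoint of `x` and `y` is also the midpoint of `0` and `x + y`.
        have h1 := hm x (y - x) (1 / 2)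
        have h2 := hsmul (1 / 2) (x + y)
        rw [show x + (1 / 2 : ℝ) • (y - x) = (1 / 2 : ℝ) • (x + y) by module, h2,
          add_sub_cancel] at h1
        have h3 := congrArg (fun z => (2 : ℝ) • z) h1
        simp only [smul_add, smul_smul] at h3
        norm_num at h3
        rw [eq_sub_of_add_eq' h3]
        abel
      map_smul' := fun θ x => by
        rw [hsmul, RingHom.id_apply]
        module }
  refine ⟨Matrix.toEuclideanLin.symm A, fun x => ?_⟩
  have h := Matrix.toLpLin_apply (p := 2) (q := 2) (Matrix.toEuclideanLin.symm A) x
  have h2 : Matrix.toEuclideanLin (Matrix.toEuclideanLin.symm A) x = m x - m 0 := by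
    rw [LinearEquiv.apply_symm_apply]
    rfl
  have h3 : m x - m 0 = WithLp.toLp 2 ((Matrix.toEuclideanLin.symm A) *ᵥ x.ofLp) :=
    h2.symm.trans h
  rw [sub_eq_iff_eq_add] at h3
  rw [h3]
  rfl

/-- The matrix `α` is twice the covariance matrix of `μ`. -/
lemma exists_posSemidef_of_variance {n : ℕ} (μ : Measure (EuclideanSpace ℝ (Fin n)))
    [IsGaussian μ] : ∃ α : Matrix (Fin n) (Fin n) ℝ, α.PosSemidef ∧
      ∀ k : Fin n → ℝ, k ⬝ᵥ (α *ᵥ k) = 2 * Var[fun y => inner ℝ (WithLp.toLp 2 k) y; μ] := by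
  let α : Matrix (Fin n) (Fin n) ℝ := Matrix.of fun i j =>
    2 * covarianceBilin μ (EuclideanSpace.single i 1) (EuclideanSpace.single j 1)
  have hα : ∀ k : Fin n → ℝ,
      k ⬝ᵥ (α *ᵥ k) = 2 * Var[fun y => inner ℝ (WithLp.toLp 2 k) y; μ] := by
    intro k
    have hk : WithLp.toLp 2 k = ∑ i, k i • EuclideanSpace.single i (1 : ℝ) := by
      ext j
      simp [Finset.sum_apply, Pi.single_apply]
    rw [← covarianceBilin_self IsGaussian.memLp_two_id, hk]
    simp only [map_sum, map_smul, FunLike.coe_sum, Finset.sum_apply, FunLike.coe_smul,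
      Pi.smul_apply, smul_eq_mul, dotProduct, mulVec, α, Matrix.of_apply, Finset.mul_sum]
    rw [Finset.sum_comm]
    refine Finset.sum_congr rfl fun i _ => Finset.sum_congr rfl fun j _ => ?_
    ring
  refine ⟨α, Matrix.PosSemidef.of_dotProduct_mulVec_nonneg ?_ fun k => ?_, hα⟩
  · ext i j
    simp [α, covarianceBilin_comm]
  · rw [star_trivial, hα]
    exact mul_nonneg zero_le_two (variance_nonneg _ _)

lemma signedCharFun_eq {n : ℕ} (μ : SignedBorel n) (k : Fin n → ℝ) :
    signedCharFun μ k
      = signedIntegral μ (BoundedContinuousFunction.innerProbChar (WithLp.toLp 2 k)) := by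
  unfold signedCharFun
  congr 1
  ext x
  rw [BoundedContinuousFunction.innerProbChar_apply, mul_comm,
    EuclideanSpace.inner_eq_star_dotProduct]
  simp

theorem mainTheorem5 (n : ℕ) (Φ : SignedBorel n →ₗ[ℝ] SignedBorel n)
    (hbdd : IsTVBounded Φ) (hfeller : IsFeller Φ)
    (hgauss : Set.MapsTo Φ (gaussianMeasures n) (gaussianMeasures n)) :
    IsMarkovOperator Φ ∧
      ∃ (K α : Matrix (Fin n) (Fin n) ℝ) (y₀ : Fin n → ℝ),
        α.PosSemidef ∧
        ∀ (μ : SignedBorel n) (k : Fin n → ℝ),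
          signedCharFun (Φ μ) k =
            signedCharFun μ (Kᵀ *ᵥ k) *
              Complex.exp (-(1 / 4 : ℂ) * ((k ⬝ᵥ (α *ᵥ k) : ℝ) : ℂ)
                + Complex.I * ((k ⬝ᵥ y₀ : ℝ) : ℂ)) := by
  obtain ⟨G, hG, hreal, hcomplex⟩ := exists_gaussianMixtureFamily hfeller hgauss
  have hGg := hG.isGaussian
  refine ⟨isMarkovOperator_of_kernel (fun x => inferInstance) hreal, ?_⟩
  have hmean : ∀ k x e, ∫ y, inner ℝ k y ∂G x e = inner ℝ k (∫ y, y ∂G x e) := fun k x e =>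
    integral_inner IsGaussian.integrable_id k
  obtain ⟨K, hK⟩ := exists_matrix_of_affine (m := fun x => ∫ y, y ∂G x 0) (fun x e θ => by
    refine ext_inner_left ℝ fun k => ?_
    rw [inner_add_right, inner_smul_right, inner_smul_right]
    simpa only [hmean] using hG.mean_affine k x e θ)
  obtain ⟨α, hα, hαk⟩ := exists_posSemidef_of_variance (G 0 0)
  refine ⟨K, α, (∫ y, y ∂G 0 0).ofLp, hα, fun μ k => ?_⟩
  have hker : ∀ x, ∫ y, BoundedContinuousFunction.innerProbChar (WithLp.toLp 2 k) y ∂G x 0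
      = BoundedContinuousFunction.innerProbChar (WithLp.toLp 2 (Kᵀ *ᵥ k)) x
        * Complex.exp (-(1 / 4 : ℂ) * ((k ⬝ᵥ (α *ᵥ k) : ℝ) : ℂ)
          + Complex.I * ((k ⬝ᵥ (∫ y, y ∂G 0 0).ofLp : ℝ) : ℂ)) := by
    intro x
    have hinner : inner ℝ (WithLp.toLp 2 k) (∫ y, y ∂G x 0)
        = (Kᵀ *ᵥ k) ⬝ᵥ x.ofLp + k ⬝ᵥ (∫ y, y ∂G 0 0).ofLp := by
      rw [real_inner_comm, EuclideanSpace.inner_eq_star_dotProduct, star_trivial, hK,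
        dotProduct_add, dotProduct_mulVec, mulVec_transpose]
    rw [← charFun_eq_integral_innerProbChar, charFun_of_isGaussian, hmean, hinner,
      hG.variance_const _ x 0, hαk, BoundedContinuousFunction.innerProbChar_apply,
      EuclideanSpace.inner_eq_star_dotProduct, star_trivial, Complex.ofReal_exp,
      ← Complex.exp_add, ← Complex.exp_add]
    congr 1
    push_cast
    ring
  rw [signedCharFun_eq, signedCharFun_eq, hcomplex]
  simp only [hker]
  have hint : ∀ ν : Measure (EuclideanSpace ℝ (Fin n)), IsFiniteMeasure ν → Integrable
      (BoundedContinuousFunction.innerProbChar (WithLp.toLp 2 (Kᵀ *ᵥ k))) ν := fun ν _ =>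
    BoundedContinuousFunction.integrable ν _
  rw [signedIntegral_eq_sub μ ((hint _ inferInstance).mul_const _)
    ((hint _ inferInstance).mul_const _), signedIntegral_eq_sub μ (hint _ inferInstance)
    (hint _ inferInstance), integral_mul_const, integral_mul_const, sub_mul]
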